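/- Let $d\ge 0$ be an integer and let $(S,\mathcal S,\mu)$ be a $\sigma$-finite standard measure space (a standard Borel space with a $\sigma$-finite measure). Let $\{\phi_t\}_{t\in\mathbb Z^d}$ be a nonsingular $\mathbb Z^d$-action on it: each $\phi_t:S\to S$ is measurable, $\phi_0=\mathrm{id}_S$, $\phi_{t+u}=\phi_t\circ\phi_u$, and $\mu\circ\phi_t^{-1}\sim\mu$ (mutual absolute continuity) for all $t,u\in\mathbb Z^d$. A measurable set $A\subseteq S$ is *wandering* if the sets $\phi_t(A)$, $t\in\mathbb Z^d$, are pairwise disjoint. The *dissipative part* of the action is the measurable union $D$ of all wandering sets, i.e. the measurable set, unique modulo $\mu$, such that $\mu(A\setminus D)=0$ for every wandering $A$, and every measurable $B\subseteq D$ with $\mu(B)>0$ contains a wandering set of positive measure. The action is *dissipative* if $\mu(S\setminus D)=0$. Actions $\{\phi_t\}_{t\in\mathbb Z^d}$ on $(S,\mathcal S,\mu)$ and $\{\psi_t\}_{t\in\mathbb Z^d}$ on $(T,\mathcal T,\nu)$ are *equivalent* if there are measurable sets $S_0\subseteq S$, $T_0\subseteq T$ with $\mu(S\setminus S_0)=0=\nu(T\setminus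 T_0)$ and a Borel isomorphism $\Phi:S_0\to T_0$ such that $\nu\sim\mu\circ\Phi^{-1}$ and, for each $t\in\mathbb Z^d$, for $\mu$-a.e. $x\in S_0$ one has $\phi_t(x)\in S_0$ and $\Phi(\phi_t(x))=\psi_t(\Phi(x))$. **Theorem (Krengel's theorem for $\mathbb Z^d$-actions).** The action $\{\phi_t\}$ is dissipative if and only if there is a $\sigma$-finite standard measure space $(W,\mathcal W,\tau)$ such that $\{\phi_t\}$ is equivalent to the $\mathbb Z^d$-action $$\psi_t(w,s)=(w,t+s),\qquad t\in\mathbb Z^d,$$ on $(W\times\mathbb Z^d,\ \tau\otimes l)$, where $l$ is the counting measure on $\mathbb Z^d$. -/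

import Mathlib

open MeasureTheory
open scoped Function

universe u

namespace NonsingularAction

/-- `φ` is a nonsingular action of the additive group `G` on the measure space `(S, μ)`:
every `φ t` is measurable, `φ` is a group action, and `μ ∘ (φ t)⁻¹ ∼ μ` for every `t`. -/
structure IsNonsingularAction {G S : Type*} [AddGroup G] [MeasurableSpace S]
    (μ : Measure S) (φ : G → S → S) : Prop where
  measurable : ∀ t, Measurable (φ t)
  zero : ∀ x, φ 0 x = x
  add : ∀ t u x, φ (t + u) x = φ t (φ u x)
  map_ac : ∀ t, μ.map (φ t) ≪ μ
  ac_map : ∀ t, μ ≪ μ.map (φ t)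

/-- A wandering set: a measurable set whose translates `φ t (A)`, `t ∈ G`, are pairwise
disjoint. -/
def IsWandering {G S : Type*} [MeasurableSpace S] (φ : G → S → S) (A : Set S) : Prop :=
  MeasurableSet A ∧ Pairwise (Disjoint on fun t : G => φ t '' A)

/-- `U` is a measurable union of the collection `C` of sets, with respect to `μ`: every member
of `C` is contained in `U` modulo `μ`, and every measurable subset of `U` of positive measure
contains a member of `C` of positive measure. Such a `U` is unique modulo `μ`. -/
def IsMeasurableUnion {S : Type*} [MeasurableSpace S] (μ : Measure S) (C : Set (Set S))
    (U : Set S) : Prop :=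
  MeasurableSet U ∧ (∀ A ∈ C, μ (A \ U) = 0) ∧
    ∀ B, MeasurableSet B → B ⊆ U → 0 < μ B → ∃ A ∈ C, A ⊆ B ∧ 0 < μ A

/-- The dissipative part of an action: the measurable union of all wandering sets (determined
up to null sets). Its complement is the conservative part. -/
def IsDissipativePart {G S : Type*} [MeasurableSpace S] (μ : Measure S) (φ : G → S → S)
    (D : Set S) : Prop :=
  IsMeasurableUnion μ {A | IsWandering φ A} D

/-- An action is dissipative if its dissipative part is the whole space modulo `μ`. -/
def IsDissipative {G S : Type*} [MeasurableSpace S] (μ : Measure S) (φ : G → S → S) : Prop :=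
  ∃ D, IsDissipativePart μ φ D ∧ μ Dᶜ = 0

/-- Equivalence of the actions `φ` on `(S, μ)` and `ψ` on `(T, ν)`: there is a Borel isomorphism
`Φ` between the measure spaces, that is, between measurable sets `S₀ ⊆ S` and `T₀ ⊆ T` of full
measure, such that `ν ∼ μ ∘ Φ⁻¹` and, for each `t`, `ψ t ∘ Φ = Φ ∘ φ t` holds `μ`-a.e.
(where "holds" includes that `Φ` is defined at `φ t x`). -/
def AreEquivalent {G S T : Type*} [MeasurableSpace S] [MeasurableSpace T]
    (μ : Measure S) (φ : G → S → S) (ν : Measure T) (ψ : G → T → T) : Prop :=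
  ∃ (S₀ : Set S) (T₀ : Set T) (Φ : S₀ ≃ᵐ T₀),
    MeasurableSet S₀ ∧ MeasurableSet T₀ ∧ μ S₀ᶜ = 0 ∧ ν T₀ᶜ = 0 ∧
    ν ≪ (μ.comap (Subtype.val : S₀ → S)).map (fun x : S₀ => (Φ x : T)) ∧
    (μ.comap (Subtype.val : S₀ → S)).map (fun x : S₀ => (Φ x : T)) ≪ ν ∧
    ∀ t, ∀ᵐ x : S₀ ∂(μ.comap (Subtype.val : S₀ → S)),
      ∃ h : φ t (x : S) ∈ S₀, (Φ ⟨φ t (x : S), h⟩ : T) = ψ t (Φ x : T)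

/-- The translation action `ψ_t (w, s) = (w, t + s)` on `W × G`. -/
def translation {G : Type*} [AddGroup G] (W : Type*) (t : G) (p : W × G) : W × G :=
  (p.1, t + p.2)

end NonsingularAction

/-!
Krengel's theorem holds because a dissipative action of a countable group admits a measurable
fundamental domain. By exhaustion, countably many wandering sets `A n` cover the space modulo `μ`
(`exists_seq_isWandering_ae_cover`). Deleting from each `A n` the orbits that meet an earlier `A k`
and taking the union gives a single wandering set `V` whose translates still cover
(`exists_isWandering_iUnion_image_ae_cover`). The map `(v, t) ↦ φ t v` is then injective on
`V × G`, so it is a Borel isomorphism onto its range by the Lusin–Souslin theorem. It intertwines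
translation with `φ`, and it matches null sets because each `φ t` does
(`measure_image_orbitMap_eq_zero_iff`).

Conversely, in `W × G` every set is the countable union of its intersections with the wandering
sets `W × {s}`. Pulling these back along an equivalence, after discarding the null set on which
equivariance fails, shows that every set of positive measure contains a wandering set of positive
measure (`isDissipative_of_areEquivalent_translation`). Nothing about `ℤ^d` is used beyond its
being a countable discrete group.
-/

namespace NonsingularAction

variable {G S : Type*} [MeasurableSpace S] {μ : Measure S} {φ : G → S → S}

/-! ### Exhaustion by wandering sets -/

theorem isWandering_empty : IsWandering φ ∅ :=
  ⟨MeasurableSet.empty, fun _ _ _ => by simp [Function.onFun]⟩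

/-- Exhaustion: the supremum of the measures of countable unions of wandering sets is attained,
for a finite measure equivalent to `μ`, and a maximizer has to be conull. -/
theorem exists_seq_isWandering_ae_cover [SigmaFinite μ] (hd : IsDissipative μ φ) :
    ∃ A : ℕ → Set S, (∀ n, IsWandering φ (A n)) ∧ μ (⋃ n, A n)ᶜ = 0 := by
  obtain ⟨D, ⟨hD, -, hDw⟩, hDc⟩ := hd
  let ν := μ.toFinite
  let m : (ℕ → {A : Set S // IsWandering φ A}) → ENNReal := fun A => ν (⋃ n, (A n).1)
  have : Nonempty {A : Set S // IsWandering φ A} := ⟨⟨∅, isWandering_empty⟩⟩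
  obtain ⟨a, -, ha, ham⟩ := exists_seq_tendsto_sSup (Set.range_nonempty m) (OrderTop.bddAbove _)
  choose F hF using ham
  -- Merging the sequences of a maximizing sequence gives a maximizer.
  let B : ℕ → {A : Set S // IsWandering φ A} := fun k => F k.unpair.1 k.unpair.2
  have hB : ∀ C, m C ≤ m B := fun C => by
    refine (le_sSup (Set.mem_range_self C)).trans (le_of_tendsto' ha fun n => ?_)
    rw [← hF n]
    refine measure_mono (Set.iUnion_subset fun k => ?_)
    have h := Set.subset_iUnion (fun j => (B j).1) (Nat.pair n k)
    simpa [B] using h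
  have hBm : MeasurableSet (⋃ n, (B n).1) := MeasurableSet.iUnion fun n => (B n).2.1
  refine ⟨fun n => (B n).1, fun n => (B n).2, ?_⟩
  have hnull : μ (D ∩ (⋃ n, (B n).1)ᶜ) = 0 := by
    by_contra hpos
    obtain ⟨A, hA, hAsub, hApos⟩ :=
      hDw _ (hD.inter hBm.compl) Set.inter_subset_left (pos_iff_ne_zero.2 hpos)
    have hdisj : Disjoint A (⋃ n, (B n).1) :=
      Set.disjoint_left.2 fun x hx => (hAsub hx).2
    have hle : ν A + m B ≤ m B := by
      calc ν A + m B = ν (A ∪ ⋃ n, (B n).1) := (measure_union hdisj hBm).symm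
        _ ≤ m (fun n => Nat.casesOn n ⟨A, hA⟩ B) := by
          refine measure_mono (Set.union_subset ?_ (Set.iUnion_subset fun n => ?_))
          · exact Set.subset_iUnion_of_subset 0 subset_rfl
          · exact Set.subset_iUnion_of_subset (n + 1) subset_rfl
        _ ≤ m B := hB _
    -- Finiteness of `ν` is what allows cancelling `m B`.
    have hA0 : ν A = 0 := by
      by_contra h0
      rw [add_comm] at hle
      exact (ENNReal.lt_add_right (measure_ne_top ν _) h0).not_ge hle
    exact hApos.ne' (absolutelyContinuous_toFinite μ hA0)
  refine measure_mono_null (t := D ∩ (⋃ n, (B n).1)ᶜ ∪ Dᶜ) (fun x hx => ?_)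
    (measure_union_null hnull hDc)
  by_cases hxD : x ∈ D
  · exact Or.inl ⟨hxD, hx⟩
  · exact Or.inr hxD

/-! ### Nonsingular actions -/

variable [AddGroup G]

namespace IsNonsingularAction

theorem neg_apply (hφ : IsNonsingularAction μ φ) (t : G) (x : S) : φ (-t) (φ t x) = x := by
  rw [← hφ.add, neg_add_cancel, hφ.zero]

theorem apply_neg (hφ : IsNonsingularAction μ φ) (t : G) (x : S) : φ t (φ (-t) x) = x := by
  rw [← hφ.add, add_neg_cancel, hφ.zero]

theorem image_eq_preimage (hφ : IsNonsingularAction μ φ) (t : G) (A : Set S) :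
    φ t '' A = φ (-t) ⁻¹' A :=
  congrFun (Set.image_eq_preimage_of_inverse (hφ.neg_apply t) (hφ.apply_neg t)) A

theorem measurableSet_image (hφ : IsNonsingularAction μ φ) (t : G) {A : Set S}
    (hA : MeasurableSet A) : MeasurableSet (φ t '' A) := by
  rw [hφ.image_eq_preimage]
  exact hφ.measurable _ hA

theorem measure_image_eq_zero_iff (hφ : IsNonsingularAction μ φ) (t : G) {A : Set S}
    (hA : MeasurableSet A) : μ (φ t '' A) = 0 ↔ μ A = 0 := by
  rw [hφ.image_eq_preimage, ← Measure.map_apply (hφ.measurable _) hA]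
  exact ⟨fun h => hφ.ac_map _ h, fun h => hφ.map_ac _ h⟩

end IsNonsingularAction

/-! ### A wandering fundamental domain -/

/-- Distinct points of a wandering set lie in distinct orbits, and the stabilizers of its points
are trivial. -/
theorem IsWandering.eq_of_apply_eq (hφ : IsNonsingularAction μ φ) {A : Set S}
    (hA : IsWandering φ A) {t u : G} {x y : S} (hx : x ∈ A) (hy : y ∈ A)
    (h : φ t x = φ u y) : t = u ∧ x = y := by
  have htu : t = u := by
    by_contra hne
    exact Set.disjoint_left.1 (hA.2 hne) ⟨x, hx, rfl⟩ ⟨y, hy, h.symm⟩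
  subst htu
  refine ⟨rfl, ?_⟩
  rw [← hφ.neg_apply t x, h, hφ.neg_apply]


/-- A fundamental domain: a wandering set whose translates cover the space modulo `μ`. -/
theorem exists_isWandering_iUnion_image_ae_cover [Countable G] [SigmaFinite μ]
    (hφ : IsNonsingularAction μ φ) (hd : IsDissipative μ φ) :
    ∃ V, IsWandering φ V ∧ μ (⋃ t, φ t '' V)ᶜ = 0 := by
  obtain ⟨A, hA, hcover⟩ := exists_seq_isWandering_ae_cover hd
  let O : ℕ → Set S := fun n => ⋃ t, φ t '' A n
  have hO : ∀ n, MeasurableSet (O n) := fun n =>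
    MeasurableSet.iUnion fun t => hφ.measurableSet_image t (hA n).1
  have hOinv : ∀ {n t x}, φ t x ∈ O n → x ∈ O n := fun {n t x} h => by
    obtain ⟨u, y, hy, hyx⟩ := Set.mem_iUnion.1 h
    refine Set.mem_iUnion.2 ⟨-t + u, y, hy, ?_⟩
    rw [hφ.add, hyx, hφ.neg_apply]
  have hAO : ∀ n, A n ⊆ O n := fun n x hx => Set.mem_iUnion.2 ⟨0, x, hx, hφ.zero x⟩
  refine ⟨⋃ n, A n \ ⋃ k < n, O k, ⟨?_, ?_⟩, measure_mono_null ?_ hcover⟩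
  · exact MeasurableSet.iUnion fun n => (hA n).1.diff
      (MeasurableSet.iUnion fun k => MeasurableSet.iUnion fun _ => hO k)
  · intro t u htu
    refine Set.disjoint_left.2 ?_
    rintro _ ⟨x, hx, rfl⟩ ⟨y, hy, hyx⟩
    obtain ⟨n, hxn, hxO⟩ := Set.mem_iUnion.1 hx
    obtain ⟨k, hyk, hyO⟩ := Set.mem_iUnion.1 hy
    -- `x` and `y` share an orbit, so they come from the same stage of the construction.
    have hxy : φ (-u + t) x = y := by rw [hφ.add, ← hyx, hφ.neg_apply]
    have hyx' : φ (-t + u) y = x := by rw [hφ.add, hyx, hφ.neg_apply]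
    rcases lt_trichotomy n k with h | rfl | h
    · exact hyO (Set.mem_biUnion h (hOinv (hyx'.symm ▸ hAO n hxn)))
    · exact htu ((hA n).eq_of_apply_eq hφ hyk hxn hyx).1.symm
    · exact hxO (Set.mem_biUnion h (hOinv (hxy.symm ▸ hAO k hyk)))
  · refine Set.compl_subset_compl.2 (Set.iUnion_subset fun n x hx => ?_)
    classical
    have hex : ∃ k, x ∈ O k := ⟨n, hAO n hx⟩
    obtain ⟨t, y, hy, rfl⟩ := Set.mem_iUnion.1 (Nat.find_spec hex)
    refine Set.mem_iUnion.2 ⟨t, y, Set.mem_iUnion.2 ⟨Nat.find hex, hy, fun hyO => ?_⟩, rfl⟩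
    obtain ⟨k, hk, hyk⟩ := Set.mem_iUnion₂.1 hyO
    refine Nat.find_min hex hk (hOinv (t := -t) ?_)
    rwa [hφ.neg_apply]

theorem sigmaFinite_comap_subtypeVal [SigmaFinite μ] {V : Set S} (hV : MeasurableSet V) :
    SigmaFinite (μ.comap (Subtype.val : V → S)) := by
  refine SigmaFinite.of_map _ measurable_subtype_coe.aemeasurable ?_
  rw [(MeasurableEmbedding.subtype_coe hV).map_comap]
  infer_instance

/-! ### From a fundamental domain to a translation action -/

/-- The map `(v, t) ↦ φ t v` on `V × G`, which parametrizes the orbits of the points of `V`. -/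
def orbitMap (φ : G → S → S) (V : Set S) (p : V × G) : S := φ p.2 p.1

omit [AddGroup G] [MeasurableSpace S] in
theorem range_orbitMap (φ : G → S → S) (V : Set S) :
    Set.range (orbitMap φ V) = ⋃ t, φ t '' V := by
  ext x
  simp only [Set.mem_range, Prod.exists, Subtype.exists, Set.mem_iUnion, Set.mem_image, orbitMap]
  grind

theorem apply_orbitMap (hφ : IsNonsingularAction μ φ) (V : Set S) (t : G) (p : V × G) :
    φ t (orbitMap φ V p) = orbitMap φ V (translation V t p) :=
  (hφ.add t p.2 p.1).symm

/-- By the Lusin–Souslin theorem, the injective Borel map `orbitMap φ V` is a measurable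
embedding. -/
theorem measurableEmbedding_orbitMap [Countable G] [MeasurableSpace G]
    [MeasurableSingletonClass G] [StandardBorelSpace S] (hφ : IsNonsingularAction μ φ)
    {V : Set S} (hV : IsWandering φ V) : MeasurableEmbedding (orbitMap φ V) := by
  have : StandardBorelSpace V := hV.1.standardBorel
  have hm : Measurable (orbitMap φ V) :=
    measurable_from_prod_countable_left fun t => (hφ.measurable t).comp measurable_subtype_coe
  refine hm.measurableEmbedding ?_
  rintro ⟨v, t⟩ ⟨w, u⟩ h
  obtain ⟨htu, hvw⟩ := hV.eq_of_apply_eq hφ v.2 w.2 h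
  exact Prod.ext (Subtype.ext hvw) htu

/-- `orbitMap φ V` matches the null sets of `μ|_V ⊗ count` with the `μ`-null subsets of its range.
The image of `E` is the countable union of the translates `φ t` of the sections of `E`. -/
theorem measure_image_orbitMap_eq_zero_iff [Countable G] [MeasurableSpace G]
    [MeasurableSingletonClass G] [SigmaFinite μ] (hφ : IsNonsingularAction μ φ)
    {V : Set S} (hV : MeasurableSet V) {E : Set (V × G)} (hE : MeasurableSet E) :
    μ (orbitMap φ V '' E) = 0 ↔ ((μ.comap Subtype.val).prod Measure.count) E = 0 := by
  have hsec : ∀ t : G, MeasurableSet ((fun v : V => (v, t)) ⁻¹' E) := fun t =>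
    measurable_prodMk_right hE
  have himage : orbitMap φ V '' E =
      ⋃ t, φ t '' (Subtype.val '' ((fun v : V => (v, t)) ⁻¹' E)) := by
    ext x
    simp [orbitMap]
    grind
  have : SigmaFinite (μ.comap (Subtype.val : V → S)) :=
    sigmaFinite_comap_subtypeVal hV
  rw [himage, measure_iUnion_null_iff, Measure.prod_apply_symm hE, lintegral_count,
    ENNReal.tsum_eq_zero]
  refine forall_congr' fun t => ?_
  rw [hφ.measure_image_eq_zero_iff t (hV.subtype_image (hsec t)),
    (MeasurableEmbedding.subtype_coe hV).comap_apply]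

theorem areEquivalent_translation_of_isWandering [Countable G] [MeasurableSpace G]
    [MeasurableSingletonClass G] [StandardBorelSpace S] [SigmaFinite μ]
    (hφ : IsNonsingularAction μ φ) {V : Set S} (hV : IsWandering φ V)
    (hcover : μ (⋃ t, φ t '' V)ᶜ = 0) :
    AreEquivalent μ φ ((μ.comap (Subtype.val : V → S)).prod (Measure.count : Measure G))
      (translation V) := by
  have hg := measurableEmbedding_orbitMap hφ hV
  let Φ : Set.range (orbitMap φ V) ≃ᵐ (Set.univ : Set (V × G)) :=
    hg.equivRange.symm.trans (MeasurableEquiv.Set.univ _).symm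
  have hΦ : ∀ x, orbitMap φ V (Φ x) = x := by
    rintro ⟨_, p, rfl⟩
    exact congrArg (orbitMap φ V) (hg.equivRange_symm_apply_mk p)
  have hΦm : Measurable fun x => (Φ x : V × G) := measurable_subtype_coe.comp Φ.measurable
  have hmap : ∀ E, MeasurableSet E →
      (μ.comap Subtype.val).map (fun x => (Φ x : V × G)) E = μ (orbitMap φ V '' E) := by
    intro E hE
    rw [Measure.map_apply hΦm hE,
      (MeasurableEmbedding.subtype_coe hg.measurableSet_range).comap_apply]
    congr 1
    ext x
    constructor
    · rintro ⟨y, hy, rfl⟩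
      exact ⟨_, hy, hΦ y⟩
    · rintro ⟨p, hp, rfl⟩
      refine ⟨⟨_, p, rfl⟩, ?_, rfl⟩
      rwa [Set.mem_preimage, hg.injective (hΦ ⟨_, p, rfl⟩)]
  refine ⟨_, Set.univ, Φ, hg.measurableSet_range, MeasurableSet.univ, ?_, by simp, ?_, ?_, ?_⟩
  · rwa [range_orbitMap]
  · refine Measure.AbsolutelyContinuous.mk fun E hE h => ?_
    rwa [hmap E hE, measure_image_orbitMap_eq_zero_iff hφ hV.1 hE] at h
  · refine Measure.AbsolutelyContinuous.mk fun E hE h => ?_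
    rwa [hmap E hE, measure_image_orbitMap_eq_zero_iff hφ hV.1 hE]
  · refine fun t => Filter.Eventually.of_forall fun x => ?_
    have hx : orbitMap φ V (translation V t (Φ x)) = φ t x := by
      rw [← apply_orbitMap hφ, hΦ]
    exact ⟨⟨_, hx⟩, hg.injective ((hΦ _).trans hx.symm)⟩

/-! ### Translation actions are dissipative -/

/-- The sets `W × {s}` are wandering for the translation action and cover `W × G`, so a set of
positive measure meets the pullback of one of them in a wandering set of positive measure. -/
theorem isDissipative_of_areEquivalent_translation [Countable G] [MeasurableSpace G]
    [MeasurableSingletonClass G] {W : Type*} [MeasurableSpace W] {ν : Measure (W × G)}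
    (h : AreEquivalent μ φ ν (translation W)) :
    IsDissipative μ φ := by
  obtain ⟨S₀, T₀, Φ, hS₀, -, hS₀c, -, -, -, heq⟩ := h
  have hval := MeasurableEmbedding.subtype_coe hS₀
  have hΦm : Measurable fun x => (Φ x : W × G) := measurable_subtype_coe.comp Φ.measurable
  -- A conull measurable subset of `S₀` on which `Φ` is equivariant.
  obtain ⟨N, hNsub, hN, hN0⟩ := exists_measurable_superset_of_null (ae_all_iff.2 heq)
  refine ⟨Set.univ, ⟨MeasurableSet.univ, fun A _ => by simp, fun B hB _ hpos => ?_⟩, by simp⟩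
  let A : G → Set S := fun s => B ∩ Subtype.val '' (Nᶜ ∩ {x : S₀ | (Φ x : W × G).2 = s})
  have hA : ∀ s, IsWandering φ (A s) := fun s => by
    refine ⟨hB.inter (hS₀.subtype_image (hN.compl.inter
      ((measurable_snd.comp hΦm) (measurableSet_singleton s)))), fun t u htu => ?_⟩
    refine Set.disjoint_left.2 ?_
    rintro _ ⟨_, ⟨-, x, ⟨hxN, hxs⟩, rfl⟩, rfl⟩ ⟨_, ⟨-, y, ⟨hyN, hys⟩, rfl⟩, hyx⟩
    have hx := not_not.1 fun hc => hxN (hNsub hc)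
    have hy := not_not.1 fun hc => hyN (hNsub hc)
    obtain ⟨hxm, hxe⟩ := hx t
    obtain ⟨hym, hye⟩ := hy u
    have hsub : (⟨φ u y, hym⟩ : S₀) = ⟨φ t x, hxm⟩ := Subtype.ext hyx
    rw [hsub, hxe] at hye
    have h2 : t + (Φ x : W × G).2 = u + (Φ y : W × G).2 := congrArg Prod.snd hye
    rw [hxs, hys] at h2
    exact htu (add_right_cancel h2)
  by_contra hne
  push Not at hne
  have hA0 : ∀ s, μ (A s) = 0 := fun s =>
    nonpos_iff_eq_zero.1 (hne _ (hA s) Set.inter_subset_left)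
  refine hpos.ne' (measure_mono_null (t := (⋃ s, A s) ∪ S₀ᶜ ∪ Subtype.val '' N) (fun x hx => ?_)
    (measure_union_null (measure_union_null (measure_iUnion_null hA0) hS₀c) ?_))
  · by_cases hx₀ : x ∈ S₀
    · by_cases hxN : (⟨x, hx₀⟩ : S₀) ∈ N
      · exact Or.inr ⟨_, hxN, rfl⟩
      · exact Or.inl (Or.inl (Set.mem_iUnion.2 ⟨_, hx, _, ⟨hxN, rfl⟩, rfl⟩))
    · exact Or.inl (Or.inr hx₀)
  · rwa [← hval.comap_apply]

end NonsingularAction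

theorem theorem2p2 (d : ℕ) (S : Type u) [MeasurableSpace S] [StandardBorelSpace S]
    (μ : Measure S) [SigmaFinite μ] (φ : (Fin d → ℤ) → S → S)
    (hφ : NonsingularAction.IsNonsingularAction μ φ) :
    NonsingularAction.IsDissipative μ φ ↔
      ∃ (W : Type u) (_ : MeasurableSpace W) (_ : StandardBorelSpace W)
        (τ : Measure W) (_ : SigmaFinite τ),
        NonsingularAction.AreEquivalent μ φ
          (τ.prod (Measure.count : Measure (Fin d → ℤ)))
          (NonsingularAction.translation W) := by
  constructor
  · intro hd
    obtain ⟨V, hV, hcover⟩ :=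
      NonsingularAction.exists_isWandering_iUnion_image_ae_cover hφ hd
    exact ⟨V, inferInstance, hV.1.standardBorel, μ.comap Subtype.val,
      NonsingularAction.sigmaFinite_comap_subtypeVal hV.1,
      NonsingularAction.areEquivalent_translation_of_isWandering hφ hV hcover⟩
  · rintro ⟨W, _, _, τ, _, h⟩
    exact NonsingularAction.isDissipative_of_areEquivalent_translation h
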